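/- Let $\alpha,\beta,\gamma>-1$ with $\alpha+\gamma+\tfrac32>0$ and $\beta+\gamma+\tfrac32>0$. Put $$a_x=\frac{(x+\alpha+1)(x+\alpha+\beta+1)}{(2x+\alpha+\beta+1)(2x+\alpha+\beta+2)},\quad c_x=\frac{x(x+\beta)}{(2x+\alpha+\beta)(2x+\alpha+\beta+1)},\quad b_x=1-a_x-c_x,\quad \delta_{x,y}=(x-y)(x+y+\alpha+\beta+1),$$ and abbreviate $N=n+\gamma+\tfrac12$. For $0\le k\le n$ let $$a_{n,k}=\tfrac12a_{N}\frac{\delta_{n+2\gamma+1,k}}{\delta_{N,k}},\quad c_{n,k}=\tfrac12c_{N}\frac{\delta_{n,k}}{\delta_{N,k}},\quad e_{n,k}=\tfrac12a_k\frac{\delta_{N,k+\gamma+1/2}}{\delta_{N,k}},\quad d_{n,k}=\tfrac12c_k\frac{\delta_{N,k-\gamma-1/2}}{\delta_{N,k}},\quad b_{n,k}=1-a_{n,k}-c_{n,k}-d_{n,k}-e_{n,k},$$ $$a^{(1)}_{n,k}=2c_ka_N\frac{\delta_{N,k-\gamma-1/2}\,\delta_{n+\gamma+1,k-\gamma-1}}{\delta_{n+\frac12(\gamma+\frac12),k-\frac12(\gamma+\frac12)}\,\delta_{n+\frac12(\gamma+\frac32),k-\frac12(\gamma+\frac32)}},\qquad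 a^{(3)}_{n,k}=2a_ka_N\frac{\delta_{N,k+\gamma+1/2}\,\delta_{n+\gamma+1,k+\gamma+1}}{\delta_{n+\frac12(\gamma+\frac12),k+\frac12(\gamma+\frac12)}\,\delta_{n+\frac12(\gamma+\frac32),k+\frac12(\gamma+\frac32)}},$$ $$c^{(1)}_{n,k}=2c_kc_N\frac{\delta_{n,k}\,\delta_{n-\frac12,k-\frac12}}{\delta_{n+\frac12(\gamma-\frac12),k+\frac12(\gamma-\frac12)}\,\delta_{n+\frac12(\gamma+\frac12),k+\frac12(\gamma+\frac12)}},\qquad c^{(3)}_{n,k}=2a_kc_N\frac{\delta_{n,k}\,\delta_{n-\frac12,k+\frac12}}{\delta_{n+\frac12(\gamma-\frac12),k-\frac12(\gamma-\frac12)}\,\delta_{n+\frac12(\gamma+\frac12),k-\frac12(\gamma+\frac12)}},$$ $$a^{(2)}_{n,k}=2(2b_k-1)a_{n,k},\quad c^{(2)}_{n,k}=2(2b_k-1)c_{n,k},\quad b^{(1)}_{n,k}=2(2b_N-1)d_{n,k},\quad b^{(3)}_{n,k}=2(2b_N-1)e_{n,k},$$ $$b^{(2)}_{n,k}=1-b^{(1)}_{n,k}-b^{(3)}_{n,k}-\sum_{i=1}^3\bigl(a^{(i)}_{n,k}+c^{(i)}_{n,k}\bigr),$$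 where common factors of numerator and denominator are cancelled (removable singularities are removed), so that all the coefficients used below are defined; those that would lead out of the index set below vanish. Index rows and columns by the states $(n,k)$, $0\le k\le n$, $n\in\mathbb N_0$. Let $J_1,J_2$ be the matrices, block tridiagonal in the level $n$, whose only possibly nonzero entries are the following. In row $(n,k)$ of $J_1$: $a_{n,k}$ in column $(n+1,k)$; $d_{n,k},b_{n,k},e_{n,k}$ in columns $(n,k-1),(n,k),(n,k+1)$; $c_{n,k}$ in column $(n-1,k)$. In row $(n,k)$ of $J_2$: $a^{(1)}_{n,k},a^{(2)}_{n,k},a^{(3)}_{n,k}$ in columns $(n+1,k-1),(n+1,k),(n+1,k+1)$; $b^{(1)}_{n,k},b^{(2)}_{n,k},b^{(3)}_{n,k}$ in columns $(n,k-1),(n,k),(n,k+1)$; $c^{(1)}_{n,k},c^{(2)}_{n,k},c^{(3)}_{n,k}$ in columns $(n-1,k-1),(n-1,k),(n-1,k+1)$. (These are the Jacobi matrices of multiplication by $u$ and by $v$ for the Jacobi–Koornwinder polynomials on the swallow tail region normalized to be $1$ at $(1,1)$.) Let $\widetilde J_1,\widetilde J_2$ be obtained from $J_1-I$ and $J_2$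 by interchanging $\alpha$ and $\beta$. (These are the matrices of multiplication by $-u$ and by $v$ for the polynomials normalized to be $1$ at $(0,1)$.) A continuous-time QBD generator is a matrix on these states that is block tridiagonal in the level, has nonnegative off-diagonal and nonpositive diagonal entries, and has all row sums equal to $0$. Let $\boldsymbol e$ be the vector with all components $1$. Then: 1. (Normalization at $(1,1)$.) For real $\tau_1,\tau_2$, $(\tau_1J_1+\tau_2J_2)\boldsymbol e=\boldsymbol 0$ if and only if $\tau_2=-\tau_1$. For no real $\tau\ne0$ does $\tau(J_2-J_1)$ have all off-diagonal entries nonnegative and all diagonal entries nonpositive. Hence $\tau_1J_1+\tau_2J_2$ with $(\tau_1,\tau_2)\neq(0,0)$ is never a continuous-time QBD generator. 2. (Normalization at $(0,1)$.) For real $\tau_1,\tau_2$, $(\tau_1\widetilde J_1+\tau_2\widetilde J_2)\boldsymbol e=\boldsymbol 0$ if and only if $\tau_2=0$. For $(\tau_1,\tau_2)\ne(0,0)$, the matrix $\tau_1\widetilde J_1+\tau_2\widetilde J_2$ is a continuous-time QBD generator if and only if $\tau_2=0$ and $\tau_1>0$, i.e. it is a positive multiple of $\widetilde J_1$. -/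

import Mathlib

noncomputable section

namespace JacobiKoornwinder

/-! ### State space, block tridiagonal matrices, continuous-time QBD generators -/

/-- The states `(n, k)` with level `n` and phase `0 ≤ k ≤ n`. -/
abbrev State : Type := Σ n : ℕ, Fin (n + 1)

/-- The semi-infinite block tridiagonal matrix whose block row `n` is `(C n, B n, A n)`, placed in
the block columns `n - 1`, `n`, `n + 1`. The `(k, l)` entry of the block `A n` is `A n k l`, where
`0 ≤ k ≤ n` and `0 ≤ l ≤ n + 1` (and `0 ≤ l ≤ n` for `B n`, `0 ≤ l ≤ n - 1` for `C n`). -/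
def blockTridiagonal (A B C : ℕ → ℕ → ℕ → ℝ) : Matrix State State ℝ := fun i j =>
  if j.1 = i.1 + 1 then A i.1 i.2 j.2
  else if j.1 = i.1 then B i.1 i.2 j.2
  else if j.1 + 1 = i.1 then C i.1 i.2 j.2
  else 0

/-- The sign conditions on an infinitesimal generator: nonnegative off-diagonal entries and
nonpositive diagonal entries. -/
def HasGeneratorSigns (P : Matrix State State ℝ) : Prop :=
  (∀ i j, i ≠ j → 0 ≤ P i j) ∧ ∀ i, P i i ≤ 0

/-- The infinitesimal generator (infinitesimal operator matrix) of a continuous-time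
quasi-birth-and-death process on `State`: block tridiagonal with respect to the levels, with the
signs of a generator, and with all row sums equal to zero. -/
structure IsQBDGenerator (P : Matrix State State ℝ) : Prop where
  block_tridiagonal : ∀ i j : State, i.1 + 1 < j.1 ∨ j.1 + 1 < i.1 → P i j = 0
  signs : HasGeneratorSigns P
  row_sum : ∀ i, HasSum (fun j => P i j) 0

/-- The entries of a tridiagonal (not necessarily square) matrix, `lo`, `di`, `up` being the
sequences on the diagonals `l = k - 1`, `l = k`, `l = k + 1`. -/
def tridiagonal (lo di up : ℕ → ℝ) (k l : ℕ) : ℝ :=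
  if l + 1 = k then lo k else if l = k then di k else if l = k + 1 then up k else 0

/-! ### Coefficients of the classical Jacobi polynomials on `[0, 1]`

`aJ`, `cJ`, `bJ` are the recurrence coefficients as rational functions of a real index `x`. At
`x = 0` the factor `α + β + 1` of `aJ` cancels; `aN` is the coefficient with integer index, with
this factor cancelled. (In `cJ` the numerator vanishes at `x = 0`.) -/

def aJ (α β x : ℝ) : ℝ :=
  (x + α + 1) * (x + α + β + 1) / ((2 * x + α + β + 1) * (2 * x + α + β + 2))

def cJ (α β x : ℝ) : ℝ :=
  x * (x + β) / ((2 * x + α + β) * (2 * x + α + β + 1))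

/-- For nonzero denominators this is
`(x+α+1)(x+1)/((2x+α+β+1)(2x+α+β+2)) + (x+β)(x+α+β)/((2x+α+β)(2x+α+β+1))`. -/
def bJ (α β x : ℝ) : ℝ := 1 - aJ α β x - cJ α β x

def aN (α β : ℝ) (k : ℕ) : ℝ := if k = 0 then (α + 1) / (α + β + 2) else aJ α β k

def cN (α β : ℝ) (k : ℕ) : ℝ := cJ α β k

def bN (α β : ℝ) (k : ℕ) : ℝ := 1 - aN α β k - cN α β k

/-- `δ_{x,y} = (x - y)(x + y + α + β + 1)`. -/
def dl (α β x y : ℝ) : ℝ := (x - y) * (x + y + α + β + 1)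

/-! ### Coefficients for the Jacobi-Koornwinder polynomials

The coefficients are products of the above `a`, `b`, `c` with quotients of values of `δ`. Such
quotients have removable singularities at admissible parameters (for instance at `γ = -1/2`, `k = n`).
Below the common factors are cancelled, after which no denominator vanishes for admissible
parameters at any entry that occurs in the matrices. The theorems `*_eq` state the uncancelled
forms. -/

/-- `(n - k + 2γ + 1) / (n - k + γ + 1/2)`, which is `2` for `k = n`. -/
def ratio (γ : ℝ) (n k : ℕ) : ℝ :=
  if k = n then 2 else ((n : ℝ) - k + 2 * γ + 1) / ((n : ℝ) - k + γ + 1 / 2)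

/-- `a_{n+γ+1/2} δ_{n+2γ+1,k} / δ_{n+γ+1/2,k}`. -/
def wA (α β γ : ℝ) (n k : ℕ) : ℝ :=
  if n = 0 then 2 * (α + γ + 3 / 2) / (α + β + 2 * γ + 3)
  else aJ α β (n + γ + 1 / 2) * ratio γ n k *
    (((n : ℝ) + k + 2 * γ + α + β + 2) / ((n : ℝ) + k + γ + α + β + 3 / 2))

/-- `c_{n+γ+1/2} δ_{n,k} / δ_{n+γ+1/2,k}`. -/
def wC (α β γ : ℝ) (n k : ℕ) : ℝ :=
  cJ α β (n + γ + 1 / 2) * (((n : ℝ) - k) * ((n : ℝ) + k + α + β + 1) /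
    (((n : ℝ) - k + γ + 1 / 2) * ((n : ℝ) + k + γ + α + β + 3 / 2)))

/-- `a_k δ_{n+γ+1/2,k+γ+1/2} / δ_{n+γ+1/2,k}`. -/
def wE (α β γ : ℝ) (n k : ℕ) : ℝ :=
  aN α β k * (((n : ℝ) - k) * ((n : ℝ) + k + 2 * γ + α + β + 2) /
    (((n : ℝ) - k + γ + 1 / 2) * ((n : ℝ) + k + γ + α + β + 3 / 2)))

/-- `c_k δ_{n+γ+1/2,k-γ-1/2} / δ_{n+γ+1/2,k}`. -/
def wD (α β γ : ℝ) (n k : ℕ) : ℝ :=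
  cN α β k * ratio γ n k *
    (((n : ℝ) + k + α + β + 1) / ((n : ℝ) + k + γ + α + β + 3 / 2))

/-! The entries of the matrix of the first variable `u`. -/

def a1 (α β γ : ℝ) (n k : ℕ) : ℝ := 1 / 2 * wA α β γ n k

def c1 (α β γ : ℝ) (n k : ℕ) : ℝ := 1 / 2 * wC α β γ n k

def e1 (α β γ : ℝ) (n k : ℕ) : ℝ := 1 / 2 * wE α β γ n k

def d1 (α β γ : ℝ) (n k : ℕ) : ℝ := 1 / 2 * wD α β γ n k

def b1 (α β γ : ℝ) (n k : ℕ) : ℝ :=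
  1 - a1 α β γ n k - c1 α β γ n k - d1 α β γ n k - e1 α β γ n k

/-! The entries of the matrix of the second variable `v`; `Lo`, `Di`, `Up` stand for the superscripts
`(1)`, `(2)`, `(3)`. -/

/-- `2 c_k a_{n+γ+1/2} δ_{n+γ+1/2,k-γ-1/2} δ_{n+γ+1,k-γ-1} /
(δ_{n+(γ+1/2)/2,k-(γ+1/2)/2} δ_{n+(γ+3/2)/2,k-(γ+3/2)/2})`. -/
def a2Lo (α β γ : ℝ) (n k : ℕ) : ℝ :=
  2 * cN α β k * aJ α β (n + γ + 1 / 2) * ratio γ n k *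
    (((n : ℝ) - k + 2 * γ + 2) / ((n : ℝ) - k + γ + 3 / 2))

def a2Di (α β γ : ℝ) (n k : ℕ) : ℝ := (2 * bN α β k - 1) * wA α β γ n k

/-- `2 a_k a_{n+γ+1/2} δ_{n+γ+1/2,k+γ+1/2} δ_{n+γ+1,k+γ+1} /
(δ_{n+(γ+1/2)/2,k+(γ+1/2)/2} δ_{n+(γ+3/2)/2,k+(γ+3/2)/2})`. -/
def a2Up (α β γ : ℝ) (n k : ℕ) : ℝ :=
  2 * aN α β k *
    if n = 0 then (α + γ + 3 / 2) / (α + β + γ + 5 / 2)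
    else aJ α β (n + γ + 1 / 2) *
      (((n : ℝ) + k + 2 * γ + α + β + 2) * ((n : ℝ) + k + 2 * γ + α + β + 3) /
        (((n : ℝ) + k + γ + α + β + 3 / 2) * ((n : ℝ) + k + γ + α + β + 5 / 2)))

def b2Lo (α β γ : ℝ) (n k : ℕ) : ℝ := (2 * bJ α β (n + γ + 1 / 2) - 1) * wD α β γ n k

def b2Up (α β γ : ℝ) (n k : ℕ) : ℝ := (2 * bJ α β (n + γ + 1 / 2) - 1) * wE α β γ n k

/-- `2 c_k c_{n+γ+1/2} δ_{n,k} δ_{n-1/2,k-1/2} /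
(δ_{n+(γ-1/2)/2,k+(γ-1/2)/2} δ_{n+(γ+1/2)/2,k+(γ+1/2)/2})`. -/
def c2Lo (α β γ : ℝ) (n k : ℕ) : ℝ :=
  2 * cN α β k * cJ α β (n + γ + 1 / 2) *
    (((n : ℝ) + k + α + β + 1) * ((n : ℝ) + k + α + β) /
      (((n : ℝ) + k + γ + α + β + 1 / 2) * ((n : ℝ) + k + γ + α + β + 3 / 2)))

def c2Di (α β γ : ℝ) (n k : ℕ) : ℝ := (2 * bN α β k - 1) * wC α β γ n k

/-- `2 a_k c_{n+γ+1/2} δ_{n,k} δ_{n-1/2,k+1/2} /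
(δ_{n+(γ-1/2)/2,k-(γ-1/2)/2} δ_{n+(γ+1/2)/2,k-(γ+1/2)/2})`. -/
def c2Up (α β γ : ℝ) (n k : ℕ) : ℝ :=
  2 * aN α β k * cJ α β (n + γ + 1 / 2) *
    (((n : ℝ) - k) * ((n : ℝ) - k - 1) /
      (((n : ℝ) - k + γ - 1 / 2) * ((n : ℝ) - k + γ + 1 / 2)))

def b2Di (α β γ : ℝ) (n k : ℕ) : ℝ :=
  1 - b2Lo α β γ n k - b2Up α β γ n k
    - a2Lo α β γ n k - a2Di α β γ n k - a2Up α β γ n k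
    - c2Lo α β γ n k - c2Di α β γ n k - c2Up α β γ n k

/-! ### The Jacobi matrices, polynomials normalized at `(1, 1)` -/

/-- The Jacobi matrix of multiplication by `u`. -/
def J1 (α β γ : ℝ) : Matrix State State ℝ :=
  blockTridiagonal
    (fun n => tridiagonal (fun _ => 0) (a1 α β γ n) (fun _ => 0))
    (fun n => tridiagonal (d1 α β γ n) (b1 α β γ n) (e1 α β γ n))
    (fun n => tridiagonal (fun _ => 0) (c1 α β γ n) (fun _ => 0))

/-- The Jacobi matrix of multiplication by `v`. -/
def J2 (α β γ : ℝ) : Matrix State State ℝ :=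
  blockTridiagonal
    (fun n => tridiagonal (a2Lo α β γ n) (a2Di α β γ n) (a2Up α β γ n))
    (fun n => tridiagonal (b2Lo α β γ n) (b2Di α β γ n) (b2Up α β γ n))
    (fun n => tridiagonal (c2Lo α β γ n) (c2Di α β γ n) (c2Up α β γ n))

/-! ### The Jacobi matrices, polynomials normalized at `(0, 1)`

The parameters `α` and `β` change places, and the diagonal blocks of the first matrix (which is
that of multiplication by `-u`) are `B - I`. -/

/-- The Jacobi matrix of multiplication by `-u`, polynomials normalized at `(0, 1)`. -/
def J1' (α β γ : ℝ) : Matrix State State ℝ :=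
  blockTridiagonal
    (fun n => tridiagonal (fun _ => 0) (a1 β α γ n) (fun _ => 0))
    (fun n => tridiagonal (d1 β α γ n) (fun k => b1 β α γ n k - 1) (e1 β α γ n))
    (fun n => tridiagonal (fun _ => 0) (c1 β α γ n) (fun _ => 0))

/-- The Jacobi matrix of multiplication by `v`, polynomials normalized at `(0, 1)`. -/
def J2' (α β γ : ℝ) : Matrix State State ℝ := J2 β α γ

/-- The admissible parameters, those for which the weight
`(1-2u+v)^α (2u+v-1)^β (2u²-2u-v+1)^γ` is integrable on the swallow tail region. -/
def Admissible (α β γ : ℝ) : Prop :=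
  -1 < α ∧ -1 < β ∧ -1 < γ ∧ 0 < α + γ + 3 / 2 ∧ 0 < β + γ + 3 / 2

/-! ### The cancelled forms agree with the uncancelled ones -/

theorem aN_eq {α β : ℝ} {k : ℕ} (h : k ≠ 0 ∨ α + β + 1 ≠ 0) : aN α β k = aJ α β k := by
  unfold aN aJ
  split_ifs with hk
  · subst hk
    have h' : α + β + 1 ≠ 0 := by simpa using h
    rw [show ((0 : ℕ) : ℝ) = 0 from Nat.cast_zero,
      show (0 + α + 1) * (0 + α + β + 1) = (α + β + 1) * (α + 1) by ring,
      show (2 * 0 + α + β + 1) * (2 * 0 + α + β + 2) = (α + β + 1) * (α + β + 2) by ring,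
      mul_div_mul_left _ _ h']
  · rfl

theorem bJ_eq {α β x : ℝ} (h0 : 2 * x + α + β ≠ 0) (h1 : 2 * x + α + β + 1 ≠ 0)
    (h2 : 2 * x + α + β + 2 ≠ 0) :
    bJ α β x = (x + α + 1) * (x + 1) / ((2 * x + α + β + 1) * (2 * x + α + β + 2)) +
      (x + β) * (x + α + β) / ((2 * x + α + β) * (2 * x + α + β + 1)) := by
  obtain ⟨y, hy⟩ : ∃ y, y = 2 * x + α + β := ⟨_, rfl⟩
  obtain rfl : β = y - 2 * x - α := by rw [hy]; ring
  rw [← hy] at h0 h1 h2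
  unfold bJ aJ cJ
  rw [← hy]
  field_simp
  ring

theorem ratio_eq {γ : ℝ} {n k : ℕ} (h : (n : ℝ) - k + γ + 1 / 2 ≠ 0) :
    ratio γ n k = ((n : ℝ) - k + 2 * γ + 1) / ((n : ℝ) - k + γ + 1 / 2) := by
  unfold ratio
  split_ifs with hk
  · subst hk
    rw [eq_div_iff h]
    ring
  · rfl

theorem wC_eq (α β γ : ℝ) (n k : ℕ) :
    wC α β γ n k = cJ α β (n + γ + 1 / 2) *
      (dl α β n k / dl α β (n + γ + 1 / 2) k) := by
  unfold wC dl
  congr 2; ring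

theorem wE_eq (α β γ : ℝ) (n k : ℕ) :
    wE α β γ n k = aN α β k *
      (dl α β (n + γ + 1 / 2) (k + γ + 1 / 2) / dl α β (n + γ + 1 / 2) k) := by
  unfold wE dl
  congr 2 <;> ring

theorem wD_eq {α β γ : ℝ} {n k : ℕ} (h : (n : ℝ) - k + γ + 1 / 2 ≠ 0) :
    wD α β γ n k = cN α β k *
      (dl α β (n + γ + 1 / 2) (k - γ - 1 / 2) / dl α β (n + γ + 1 / 2) k) := by
  unfold wD dl
  rw [ratio_eq h, mul_assoc, div_mul_div_comm]
  congr 2 <;> ring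

theorem wA_eq {α β γ : ℝ} {n k : ℕ} (hk : k ≤ n) (h : dl α β (n + γ + 1 / 2) k ≠ 0)
    (h1 : 2 * ((n : ℝ) + γ + 1 / 2) + α + β + 1 ≠ 0) :
    wA α β γ n k = aJ α β (n + γ + 1 / 2) *
      (dl α β (n + 2 * γ + 1) k / dl α β (n + γ + 1 / 2) k) := by
  have hd := mul_ne_zero_iff.1 h
  have hm : (n : ℝ) - k + γ + 1 / 2 ≠ 0 := by convert hd.1 using 1; ring
  unfold wA
  split_ifs with hn
  · subst hn
    obtain rfl : k = 0 := Nat.le_zero.1 hk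
    simp only [dl, aJ, Nat.cast_zero] at *
    by_cases h3 : α + β + 2 * γ + 3 = 0
    · rw [show 2 * (0 + γ + 1 / 2) + α + β + 2 = α + β + 2 * γ + 3 by ring, h3]; simp
    have e1 : 0 + γ + 1 / 2 - 0 = γ + 1 / 2 := by ring
    have e2 : 0 + γ + 1 / 2 + 0 + α + β + 1 = γ + 1 / 2 + α + β + 1 := by ring
    have e3 : 2 * (0 + γ + 1 / 2) + α + β + 1 = α + β + 2 * γ + 2 := by ring
    have e4 : 2 * (0 + γ + 1 / 2) + α + β + 2 = α + β + 2 * γ + 3 := by ring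
    rw [e1, e2] at hd
    obtain ⟨g1, g2⟩ := hd
    rw [e3] at h1
    rw [e1, e2, e3, e4, div_mul_div_comm,
      div_eq_div_iff h3 (mul_ne_zero (mul_ne_zero h1 h3) (mul_ne_zero g1 g2))]
    ring
  · unfold dl
    rw [ratio_eq hm, mul_assoc, div_mul_div_comm]
    congr 2 <;> ring

theorem a2Lo_eq {α β γ : ℝ} {n k : ℕ} (h : (n : ℝ) - k + γ + 1 / 2 ≠ 0)
    (hp : (n : ℝ) + k + α + β + 1 ≠ 0) :
    a2Lo α β γ n k = 2 * cN α β k * aJ α β (n + γ + 1 / 2) *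
      (dl α β (n + γ + 1 / 2) (k - γ - 1 / 2) * dl α β (n + γ + 1) (k - γ - 1) /
        (dl α β (n + 1 / 2 * (γ + 1 / 2)) (k - 1 / 2 * (γ + 1 / 2)) *
          dl α β (n + 1 / 2 * (γ + 3 / 2)) (k - 1 / 2 * (γ + 3 / 2)))) := by
  unfold a2Lo dl
  rw [ratio_eq h, mul_assoc _ (_ / _) (_ / _), div_mul_div_comm,
    ← mul_div_mul_right (((n : ℝ) - k + 2 * γ + 1) * ((n : ℝ) - k + 2 * γ + 2)) _
      (mul_ne_zero hp hp)]
  congr 2 <;> ring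

theorem a2Up_eq {α β γ : ℝ} {n k : ℕ} (hn : n ≠ 0) (hk : (n : ℝ) - k ≠ 0) :
    a2Up α β γ n k = 2 * aN α β k * aJ α β (n + γ + 1 / 2) *
      (dl α β (n + γ + 1 / 2) (k + γ + 1 / 2) * dl α β (n + γ + 1) (k + γ + 1) /
        (dl α β (n + 1 / 2 * (γ + 1 / 2)) (k + 1 / 2 * (γ + 1 / 2)) *
          dl α β (n + 1 / 2 * (γ + 3 / 2)) (k + 1 / 2 * (γ + 3 / 2)))) := by
  unfold a2Up dl
  rw [if_neg hn, ← mul_div_mul_right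
    (((n : ℝ) + k + 2 * γ + α + β + 2) * ((n : ℝ) + k + 2 * γ + α + β + 3)) _
    (mul_ne_zero hk hk), ← mul_assoc]
  congr 2 <;> ring

theorem c2Lo_eq {α β γ : ℝ} {n k : ℕ} (hk : (n : ℝ) - k ≠ 0) :
    c2Lo α β γ n k = 2 * cN α β k * cJ α β (n + γ + 1 / 2) *
      (dl α β n k * dl α β (n - 1 / 2) (k - 1 / 2) /
        (dl α β (n + 1 / 2 * (γ - 1 / 2)) (k + 1 / 2 * (γ - 1 / 2)) *
          dl α β (n + 1 / 2 * (γ + 1 / 2)) (k + 1 / 2 * (γ + 1 / 2)))) := by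
  unfold c2Lo dl
  rw [← mul_div_mul_right (((n : ℝ) + k + α + β + 1) * ((n : ℝ) + k + α + β)) _
    (mul_ne_zero hk hk)]
  congr 2 <;> ring

theorem c2Up_eq {α β γ : ℝ} {n k : ℕ} (hp : (n : ℝ) + k + α + β + 1 ≠ 0) :
    c2Up α β γ n k = 2 * aN α β k * cJ α β (n + γ + 1 / 2) *
      (dl α β n k * dl α β (n - 1 / 2) (k + 1 / 2) /
        (dl α β (n + 1 / 2 * (γ - 1 / 2)) (k - 1 / 2 * (γ - 1 / 2)) *
          dl α β (n + 1 / 2 * (γ + 1 / 2)) (k - 1 / 2 * (γ + 1 / 2)))) := by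
  unfold c2Up dl
  rw [← mul_div_mul_right (((n : ℝ) - k) * ((n : ℝ) - k - 1)) _ (mul_ne_zero hp hp)]
  congr 2 <;> ring

end JacobiKoornwinder

end

namespace JacobiKoornwinder

/-! ### Row sums -/

/-! Each diagonal coefficient is one minus all the others, and the coefficients leading out of the
state space vanish, so every row of `J1` and `J2` sums to 1. The shift by the identity makes the
rows of `J1'` sum to 0, while those of `J2'` still sum to 1. A combination therefore has zero row
sums exactly when `τ₁ + τ₂ = 0` at `(1, 1)`, and exactly when `τ₂ = 0` at `(0, 1)`.

At `(1, 1)` it remains to exclude the multiples of `J2 - J1`, which has off-diagonal entries of both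
signs (`Admissible.not_hasGeneratorSigns_smul_sub`). The entry from `(0, 0)` to `(1, 1)` is
positive, since it comes from `J2` alone. The entry from `(k, k)` to `(k + 1, k)` is `(2 b_k - 3/2)`
times a positive weight, and it is negative for large `k` because `b_k → 1/2`.

At `(0, 1)` all off-diagonal coefficients of `J1'` are nonnegative and its diagonal is minus their
sum (`Admissible.hasGeneratorSigns_J1'`). A single positive entry then forces the sign of the
multiplier. -/

theorem tridiagonal_eq_add (lo di up : ℕ → ℝ) (k l : ℕ) :
    tridiagonal lo di up k l =
      (if l + 1 = k then lo k else 0) + (if l = k then di k else 0) +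
        (if l = k + 1 then up k else 0) := by
  unfold tridiagonal
  split_ifs <;> first | omega | simp

/-- The three implications say that a coefficient vanishes whenever its column falls outside the
block. The width `M` is `n`, `n + 1` or `n + 2` for the three blocks of a row; `k = M` does occur,
for the lower block at `k = n`. -/
theorem sum_range_tridiagonal {lo di up : ℕ → ℝ} {k M : ℕ} (hk : k ≤ M) (hlo : k = 0 → lo k = 0)
    (hdi : M ≤ k → di k = 0) (hup : M ≤ k + 1 → up k = 0) :
    ∑ l ∈ Finset.range M, tridiagonal lo di up k l = lo k + di k + up k := by
  simp only [tridiagonal_eq_add, Finset.sum_add_distrib]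
  congr 1
  · congr 1
    · rcases Nat.eq_zero_or_pos k with h0 | h0
      · simp [hlo h0]
      · rw [Finset.sum_eq_single_of_mem (k - 1) (Finset.mem_range.2 (by omega))
          (fun l _ hl => if_neg (by omega)), if_pos (by omega)]
    · rw [Finset.sum_ite_eq' (Finset.range M) k (fun _ => di k)]
      split_ifs with h
      · rfl
      · exact (hdi (by simpa using h)).symm
  · rw [Finset.sum_ite_eq' (Finset.range M) (k + 1) (fun _ => up k)]
    split_ifs with h
    · rfl
    · exact (hup (by simpa using h)).symm

theorem hasSum_blockTridiagonal (A B C : ℕ → ℕ → ℕ → ℝ) (i : State) :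
    HasSum (fun j => blockTridiagonal A B C i j)
      ((∑ l ∈ Finset.range i.1, C i.1 i.2 l) + (∑ l ∈ Finset.range (i.1 + 1), B i.1 i.2 l) +
        ∑ l ∈ Finset.range (i.1 + 2), A i.1 i.2 l) := by
  obtain ⟨n, k⟩ := i
  have key : HasSum (fun j => blockTridiagonal A B C ⟨n, k⟩ j)
      (∑ j ∈ (Finset.range (n + 2)).sigma (fun m => (Finset.univ : Finset (Fin (m + 1)))),
        blockTridiagonal A B C ⟨n, k⟩ j) := by
    -- The row is supported on levels below `n + 2`, so the infinite sum is a finite one.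
    refine hasSum_sum_of_ne_finset_zero fun j hj => ?_
    have hj' : n + 2 ≤ j.1 := by simpa using hj
    simp only [blockTridiagonal]
    rw [if_neg (by omega), if_neg (by omega), if_neg (by omega)]
  convert key using 1
  rw [Finset.sum_sigma]
  simp only [blockTridiagonal]
  refine Eq.trans ?_ (Finset.sum_range_succ _ _).symm
  congr 1
  · refine Eq.trans ?_ (Finset.sum_range_succ _ _).symm
    congr 1
    · cases n with
      -- Level 0 has no level below it, and the sum over the `C` block is empty.
      | zero => simp
      | succ n =>
        refine Eq.trans ?_ (Finset.sum_range_succ _ _).symm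
        rw [← Fin.sum_univ_eq_sum_range, Finset.sum_eq_zero (s := Finset.range n), zero_add]
        · exact Finset.sum_congr rfl fun l _ => by
            rw [if_neg (by omega), if_neg (by omega), if_pos rfl]
        · intro m hm
          have := Finset.mem_range.1 hm
          exact Finset.sum_eq_zero fun l _ => by
            rw [if_neg (by omega), if_neg (by omega), if_neg (by omega)]
    · rw [← Fin.sum_univ_eq_sum_range]
      exact Finset.sum_congr rfl fun l _ => by simp
  · rw [← Fin.sum_univ_eq_sum_range]
    exact Finset.sum_congr rfl fun l _ => by simp

theorem cN_zero (α β : ℝ) : cN α β 0 = 0 := by simp [cN, cJ]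

theorem wD_zero (α β γ : ℝ) (n : ℕ) : wD α β γ n 0 = 0 := by simp [wD, cN_zero]

theorem wE_self (α β γ : ℝ) (n : ℕ) : wE α β γ n n = 0 := by simp [wE]

theorem wC_self (α β γ : ℝ) (n : ℕ) : wC α β γ n n = 0 := by simp [wC]

/-- The product `(n - k)(n - k - 1)` kills both phases, `k = n` and `k = n - 1`, whose successor is
missing on level `n - 1`. -/
theorem c2Up_eq_zero (α β γ : ℝ) {n k : ℕ} (hk : k ≤ n) (h : n ≤ k + 1) :
    c2Up α β γ n k = 0 := by
  obtain rfl | rfl : n = k ∨ n = k + 1 := by omega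
  · simp [c2Up]
  · simp [c2Up]

theorem hasSum_J1 (α β γ : ℝ) (i : State) : HasSum (fun j => J1 α β γ i j) 1 := by
  have key : HasSum (fun j => J1 α β γ i j) _ := hasSum_blockTridiagonal _ _ _ i
  convert key using 1
  have hk : (i.2 : ℕ) ≤ i.1 := Nat.lt_succ_iff.1 i.2.2
  rw [sum_range_tridiagonal hk (by simp)
      (fun h => by rw [le_antisymm hk h, c1, wC_self, mul_zero]) (by simp),
    sum_range_tridiagonal (by omega) (fun h => by rw [h, d1, wD_zero, mul_zero]) (by omega)
      (fun h => by rw [le_antisymm hk (by omega), e1, wE_self, mul_zero]),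
    sum_range_tridiagonal (by omega) (by simp) (by omega) (by simp)]
  simp only [b1]
  ring

theorem hasSum_J1' (α β γ : ℝ) (i : State) : HasSum (fun j => J1' α β γ i j) 0 := by
  have key : HasSum (fun j => J1' α β γ i j) _ := hasSum_blockTridiagonal _ _ _ i
  convert key using 1
  have hk : (i.2 : ℕ) ≤ i.1 := Nat.lt_succ_iff.1 i.2.2
  rw [sum_range_tridiagonal hk (by simp)
      (fun h => by rw [le_antisymm hk h, c1, wC_self, mul_zero]) (by simp),
    sum_range_tridiagonal (by omega) (fun h => by rw [h, d1, wD_zero, mul_zero]) (by omega)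
      (fun h => by rw [le_antisymm hk (by omega), e1, wE_self, mul_zero]),
    sum_range_tridiagonal (by omega) (by simp) (by omega) (by simp)]
  simp only [b1]
  ring

theorem hasSum_J2 (α β γ : ℝ) (i : State) : HasSum (fun j => J2 α β γ i j) 1 := by
  have key : HasSum (fun j => J2 α β γ i j) _ := hasSum_blockTridiagonal _ _ _ i
  convert key using 1
  have hk : (i.2 : ℕ) ≤ i.1 := Nat.lt_succ_iff.1 i.2.2
  rw [sum_range_tridiagonal hk (fun h => by simp [h, c2Lo, cN_zero])
      (fun h => by rw [le_antisymm hk h, c2Di, wC_self, mul_zero]) (c2Up_eq_zero _ _ _ hk),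
    sum_range_tridiagonal (by omega) (fun h => by rw [h, b2Lo, wD_zero, mul_zero]) (by omega)
      (fun h => by rw [le_antisymm hk (by omega), b2Up, wE_self, mul_zero]),
    sum_range_tridiagonal (by omega) (fun h => by simp [h, a2Lo, cN_zero]) (by omega) (by omega)]
  simp only [b2Di]
  ring

theorem hasSum_smul_add_smul {P Q : Matrix State State ℝ} {i : State} {p q : ℝ}
    (hP : HasSum (fun j => P i j) p) (hQ : HasSum (fun j => Q i j) q) (s t : ℝ) :
    HasSum (fun j => (s • P + t • Q) i j) (s * p + t * q) :=
  (hP.mul_left s).add (hQ.mul_left t)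

theorem forall_hasSum_J1_J2_iff (α β γ s t : ℝ) :
    (∀ i, HasSum (fun j => (s • J1 α β γ + t • J2 α β γ) i j) 0) ↔ t = -s := by
  have h i := hasSum_smul_add_smul (hasSum_J1 α β γ i) (hasSum_J2 α β γ i) s t
  constructor
  · intro h0
    -- All rows have the same sum, so one row decides.
    have := (h0 ⟨0, 0⟩).unique (h ⟨0, 0⟩)
    linarith
  · rintro rfl i
    simpa using h i

theorem forall_hasSum_J1'_J2'_iff (α β γ s t : ℝ) :
    (∀ i, HasSum (fun j => (s • J1' α β γ + t • J2' α β γ) i j) 0) ↔ t = 0 := by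
  have h i := hasSum_smul_add_smul (hasSum_J1' α β γ i) (hasSum_J2 β α γ i) s t
  constructor
  · intro h0
    have := (h0 ⟨0, 0⟩).unique (h ⟨0, 0⟩)
    linarith
  · rintro rfl i
    simpa using h i

/-! ### Signs of the coefficients -/

section Signs

variable {α β γ : ℝ}

theorem Admissible.symm (h : Admissible α β γ) : Admissible β α γ :=
  ⟨h.2.1, h.1, h.2.2.1, h.2.2.2.2, h.2.2.2.1⟩

theorem aN_pos (hα : -1 < α) (hβ : -1 < β) (k : ℕ) : 0 < aN α β k := by
  unfold aN aJ
  split_ifs with hk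
  · exact div_pos (by linarith) (by linarith)
  · have : (1 : ℝ) ≤ k := Nat.one_le_cast.2 (Nat.one_le_iff_ne_zero.2 hk)
    exact div_pos (mul_pos (by linarith) (by linarith)) (mul_pos (by linarith) (by linarith))

theorem cN_nonneg (hα : -1 < α) (hβ : -1 < β) (k : ℕ) : 0 ≤ cN α β k := by
  rcases Nat.eq_zero_or_pos k with rfl | hk
  · exact (cN_zero α β).ge
  · have : (1 : ℝ) ≤ k := Nat.one_le_cast.2 hk
    exact div_nonneg (mul_nonneg (by linarith) (by linarith))
      (mul_nonneg (by linarith) (by linarith))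

/-- Level 0 must be excluded: there `2γ + α + β + 2` and `γ + α + β + 3/2` may be zero or negative.
Only their cancelled quotient, used in `wA`, is harmless. -/
theorem Admissible.aJ_pos (h : Admissible α β γ) {n : ℕ} (hn : n ≠ 0) :
    0 < aJ α β (n + γ + 1 / 2) := by
  obtain ⟨hα, hβ, hγ, h1, h2⟩ := h
  have : (1 : ℝ) ≤ n := Nat.one_le_cast.2 (Nat.one_le_iff_ne_zero.2 hn)
  exact div_pos (mul_pos (by linarith) (by linarith)) (mul_pos (by linarith) (by linarith))

theorem Admissible.cJ_nonneg (h : Admissible α β γ) {n : ℕ} (hn : n ≠ 0) :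
    0 ≤ cJ α β (n + γ + 1 / 2) := by
  obtain ⟨hα, hβ, hγ, h1, h2⟩ := h
  have : (1 : ℝ) ≤ n := Nat.one_le_cast.2 (Nat.one_le_iff_ne_zero.2 hn)
  exact div_nonneg (mul_nonneg (by linarith) (by linarith))
    (mul_nonneg (by linarith) (by linarith))

theorem ratio_pos (hγ : -1 < γ) {n k : ℕ} (hk : k ≤ n) : 0 < ratio γ n k := by
  unfold ratio
  split_ifs with h
  · norm_num
  · have : (k : ℝ) + 1 ≤ n := by exact_mod_cast (show k + 1 ≤ n by omega)
    exact div_pos (by linarith) (by linarith)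

theorem Admissible.wA_pos (h : Admissible α β γ) {n k : ℕ} (hk : k ≤ n) :
    0 < wA α β γ n k := by
  unfold wA
  split_ifs with hn
  · obtain ⟨hα, hβ, hγ, h1, h2⟩ := h
    exact div_pos (by linarith) (by linarith)
  · refine mul_pos (mul_pos (h.aJ_pos hn) (ratio_pos h.2.2.1 hk)) ?_
    obtain ⟨hα, hβ, hγ, h1, h2⟩ := h
    have : (1 : ℝ) ≤ n := Nat.one_le_cast.2 (Nat.one_le_iff_ne_zero.2 hn)
    have := Nat.cast_nonneg (α := ℝ) k
    exact div_pos (by linarith) (by linarith)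

/-- For `k = n` the factor `n - k` vanishes. Otherwise `n ≥ 1`, which is what `Admissible.cJ_nonneg`
needs. -/
theorem Admissible.wC_nonneg (h : Admissible α β γ) {n k : ℕ} (hk : k ≤ n) :
    0 ≤ wC α β γ n k := by
  obtain rfl | hlt := hk.eq_or_lt
  · exact (wC_self α β γ k).ge
  refine mul_nonneg (h.cJ_nonneg (by omega)) ?_
  obtain ⟨hα, hβ, hγ, h1, h2⟩ := h
  have : (k : ℝ) + 1 ≤ n := by exact_mod_cast hlt
  have := Nat.cast_nonneg (α := ℝ) k
  exact div_nonneg (mul_nonneg (by linarith) (by linarith))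
    (mul_nonneg (by linarith) (by linarith))

theorem Admissible.wE_nonneg (h : Admissible α β γ) {n k : ℕ} (hk : k ≤ n) :
    0 ≤ wE α β γ n k := by
  obtain rfl | hlt := hk.eq_or_lt
  · exact (wE_self α β γ k).ge
  refine mul_nonneg (aN_pos h.1 h.2.1 k).le ?_
  obtain ⟨hα, hβ, hγ, h1, h2⟩ := h
  have : (k : ℝ) + 1 ≤ n := by exact_mod_cast hlt
  have := Nat.cast_nonneg (α := ℝ) k
  exact div_nonneg (mul_nonneg (by linarith) (by linarith))
    (mul_nonneg (by linarith) (by linarith))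

theorem Admissible.wD_nonneg (h : Admissible α β γ) {n k : ℕ} (hk : k ≤ n) :
    0 ≤ wD α β γ n k := by
  -- At `n = k = 0` the factor `n + k + α + β + 1` may be negative, but `c_0 = 0`.
  rcases Nat.eq_zero_or_pos k with rfl | hpos
  · exact (wD_zero α β γ n).ge
  refine mul_nonneg (mul_nonneg (cN_nonneg h.1 h.2.1 k) (ratio_pos h.2.2.1 hk).le) ?_
  obtain ⟨hα, hβ, hγ, h1, h2⟩ := h
  have : (1 : ℝ) ≤ k := Nat.one_le_cast.2 hpos
  have : (k : ℝ) ≤ n := by exact_mod_cast hk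
  exact div_nonneg (by linarith) (by linarith)

theorem tridiagonal_nonneg {lo di up : ℕ → ℝ} {k l : ℕ} (hlo : 0 ≤ lo k) (hup : 0 ≤ up k)
    (hdi : l = k → 0 ≤ di k) : 0 ≤ tridiagonal lo di up k l := by
  unfold tridiagonal
  split_ifs with h1 h2
  exacts [hlo, hdi h2, hup, le_rfl]

theorem Admissible.hasGeneratorSigns_J1' (h : Admissible α β γ) :
    HasGeneratorSigns (J1' α β γ) := by
  constructor
  · rintro ⟨n, k⟩ ⟨m, l⟩ hij
    have hk : (k : ℕ) ≤ n := Nat.lt_succ_iff.1 k.2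
    simp only [J1', blockTridiagonal]
    split_ifs with h1 h2
    · exact tridiagonal_nonneg le_rfl le_rfl
        fun _ => mul_nonneg (by norm_num) (h.symm.wA_pos hk).le
    · subst h2
      exact tridiagonal_nonneg (mul_nonneg (by norm_num) (h.symm.wD_nonneg hk))
        (mul_nonneg (by norm_num) (h.symm.wE_nonneg hk)) fun hlk => (hij (by
          rw [Fin.ext hlk])).elim
    · exact tridiagonal_nonneg le_rfl le_rfl
        fun _ => mul_nonneg (by norm_num) (h.symm.wC_nonneg hk)
    · exact le_rfl
  · rintro ⟨n, k⟩
    have hk : (k : ℕ) ≤ n := Nat.lt_succ_iff.1 k.2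
    have hA := h.symm.wA_pos hk
    have hC := h.symm.wC_nonneg hk
    have hD := h.symm.wD_nonneg hk
    have hE := h.symm.wE_nonneg hk
    -- The diagonal entry is `b - 1 = -(a + c + d + e)`.
    simp [J1', blockTridiagonal, tridiagonal, b1, a1, c1, d1, e1]
    linarith

theorem HasGeneratorSigns.smul {P : Matrix State State ℝ} (h : HasGeneratorSigns P) {t : ℝ}
    (ht : 0 ≤ t) : HasGeneratorSigns (t • P) :=
  ⟨fun i j hij => mul_nonneg ht (h.1 i j hij),
    fun i => mul_nonpos_of_nonneg_of_nonpos ht (h.2 i)⟩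

theorem Admissible.isQBDGenerator_smul_J1' (h : Admissible α β γ) {t : ℝ} (ht : 0 ≤ t) :
    IsQBDGenerator (t • J1' α β γ) where
  block_tridiagonal i j hij := by
    simp only [Matrix.smul_apply, J1', blockTridiagonal]
    rw [if_neg (by omega), if_neg (by omega), if_neg (by omega), smul_zero]
  signs := h.hasGeneratorSigns_J1'.smul ht
  row_sum i := by simpa using (hasSum_J1' α β γ i).mul_left t

theorem Admissible.nonneg_of_hasGeneratorSigns_smul_J1' (h : Admissible α β γ) {t : ℝ}
    (ht : HasGeneratorSigns (t • J1' α β γ)) : 0 ≤ t := by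
  have h01 := ht.1 ⟨0, 0⟩ ⟨1, 0⟩ (by simp)
  have hA := h.symm.wA_pos (le_refl 0)
  have : J1' α β γ ⟨0, 0⟩ ⟨1, 0⟩ = 1 / 2 * wA β α γ 0 0 := by
    simp [J1', blockTridiagonal, tridiagonal, a1]
  rw [Matrix.smul_apply, this, smul_eq_mul] at h01
  exact nonneg_of_mul_nonneg_left h01 (by linarith)

/-! ### The difference of the two Jacobi matrices -/

/-- This makes `b_k → 1/2` visible: the numerator is constant in `k` and the denominator is
quadratic. -/
theorem two_mul_bN_sub_one (hα : -1 < α) (hβ : -1 < β) {k : ℕ} (hk : k ≠ 0) :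
    2 * bN α β k - 1 = (β ^ 2 - α ^ 2) / ((2 * k + α + β) * (2 * k + α + β + 2)) := by
  have : (1 : ℝ) ≤ k := Nat.one_le_cast.2 (Nat.one_le_iff_ne_zero.2 hk)
  have h0 : 2 * (k : ℝ) + α + β ≠ 0 := by linarith
  have h1 : 2 * (k : ℝ) + α + β + 1 ≠ 0 := by linarith
  have h2 : 2 * (k : ℝ) + α + β + 2 ≠ 0 := by linarith
  unfold bN aN cN aJ cJ
  rw [if_neg hk]
  field_simp
  ring

theorem exists_bN_lt (hα : -1 < α) (hβ : -1 < β) : ∃ k, bN α β k < 3 / 4 := by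
  -- Since `α + β > -2`, this choice gives `2k + α + β > 2β²`, so the denominator exceeds `2(β² -
  -- α²)`.
  obtain ⟨k, hk⟩ := exists_nat_gt (β ^ 2 + 1)
  have hβ2 := sq_nonneg β
  have hα2 := sq_nonneg α
  have hk0 : k ≠ 0 := by rintro rfl; norm_num at hk; linarith
  refine ⟨k, ?_⟩
  have h0 : 2 * β ^ 2 < 2 * (k : ℝ) + α + β := by linarith
  have h2 : 2 < 2 * (k : ℝ) + α + β + 2 := by linarith
  have : 2 * bN α β k - 1 < 1 / 2 := by
    rw [two_mul_bN_sub_one hα hβ hk0, div_lt_iff₀ (mul_pos (by linarith) (by linarith))]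
    nlinarith
  linarith

theorem Admissible.not_hasGeneratorSigns_smul_sub (h : Admissible α β γ) {t : ℝ} (ht : t ≠ 0) :
    ¬ HasGeneratorSigns (t • (J2 α β γ - J1 α β γ)) := by
  intro hs
  rcases ht.lt_or_gt with ht | ht
  -- For negative `t`: `J1` never changes level and phase together, so only `J2` contributes here.
  · have h01 := hs.1 ⟨0, 0⟩ ⟨1, 1⟩ (by simp)
    have hentry : (J2 α β γ - J1 α β γ) ⟨0, 0⟩ ⟨1, 1⟩ = a2Up α β γ 0 0 := by
      simp [J1, J2, blockTridiagonal, tridiagonal]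
    have hpos : 0 < a2Up α β γ 0 0 := by
      have ha := aN_pos h.1 h.2.1 0
      obtain ⟨hα, hβ, hγ, h1, h2⟩ := h
      unfold a2Up
      rw [if_pos rfl]
      exact mul_pos (by linarith) (div_pos (by linarith) (by linarith))
    rw [Matrix.smul_apply, hentry, smul_eq_mul] at h01
    exact h01.not_gt (mul_neg_of_neg_of_pos ht hpos)
  -- For positive `t`: the bound `3/4` is where `2 b_k - 1` equals the factor `1/2` in `a1`.
  · obtain ⟨k, hk⟩ := exists_bN_lt h.1 h.2.1
    have h01 := hs.1 ⟨k, Fin.last k⟩ ⟨k + 1, (Fin.last k).castSucc⟩ (by simp)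
    have hentry : (J2 α β γ - J1 α β γ) ⟨k, Fin.last k⟩ ⟨k + 1, (Fin.last k).castSucc⟩ =
        (2 * bN α β k - 1) * wA α β γ k k - 1 / 2 * wA α β γ k k := by
      simp [J1, J2, blockTridiagonal, tridiagonal, a1, a2Di]
    have hA := h.wA_pos (le_refl k)
    rw [Matrix.smul_apply, hentry, smul_eq_mul, ← sub_mul] at h01
    exact h01.not_gt (mul_neg_of_pos_of_neg ht (mul_neg_of_neg_of_pos (by linarith) hA))

end Signs

end JacobiKoornwinder

theorem mainTheorem6 (α β γ : ℝ) (h : JacobiKoornwinder.Admissible α β γ) :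
    -- normalization at `(1, 1)`
    ((∀ τ₁ τ₂ : ℝ,
        (∀ i, HasSum (fun j => (τ₁ • JacobiKoornwinder.J1 α β γ +
          τ₂ • JacobiKoornwinder.J2 α β γ) i j) 0) ↔ τ₂ = -τ₁) ∧
      (∀ τ : ℝ, τ ≠ 0 → ¬ JacobiKoornwinder.HasGeneratorSigns
        (τ • (JacobiKoornwinder.J2 α β γ - JacobiKoornwinder.J1 α β γ))) ∧
      (∀ τ₁ τ₂ : ℝ, (τ₁, τ₂) ≠ (0, 0) → ¬ JacobiKoornwinder.IsQBDGenerator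
        (τ₁ • JacobiKoornwinder.J1 α β γ + τ₂ • JacobiKoornwinder.J2 α β γ))) ∧
    -- normalization at `(0, 1)`
    ((∀ τ₁ τ₂ : ℝ,
        (∀ i, HasSum (fun j => (τ₁ • JacobiKoornwinder.J1' α β γ +
          τ₂ • JacobiKoornwinder.J2' α β γ) i j) 0) ↔ τ₂ = 0) ∧
      (∀ τ₁ τ₂ : ℝ, (τ₁, τ₂) ≠ (0, 0) →
        (JacobiKoornwinder.IsQBDGenerator
          (τ₁ • JacobiKoornwinder.J1' α β γ + τ₂ • JacobiKoornwinder.J2' α β γ) ↔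
            τ₂ = 0 ∧ 0 < τ₁))) := by
  refine ⟨⟨JacobiKoornwinder.forall_hasSum_J1_J2_iff α β γ,
    fun τ hτ => h.not_hasGeneratorSigns_smul_sub hτ, fun τ₁ τ₂ hτ hQ => ?_⟩,
    JacobiKoornwinder.forall_hasSum_J1'_J2'_iff α β γ, fun τ₁ τ₂ hτ => ⟨fun hQ => ?_, ?_⟩⟩
  · obtain rfl := (JacobiKoornwinder.forall_hasSum_J1_J2_iff α β γ τ₁ τ₂).1 hQ.row_sum
    -- With `τ₂ = -τ₁` the combination is `-τ₁ (J2 - J1)`.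
    refine h.not_hasGeneratorSigns_smul_sub (t := -τ₁) (by rintro h0; simp_all) ?_
    convert hQ.signs using 1
    module
  · obtain rfl := (JacobiKoornwinder.forall_hasSum_J1'_J2'_iff α β γ τ₁ τ₂).1 hQ.row_sum
    have hs := hQ.signs
    rw [zero_smul, add_zero] at hs
    exact ⟨rfl, (h.nonneg_of_hasGeneratorSigns_smul_J1' hs).lt_of_ne (by rintro rfl; simp at hτ)⟩
  · rintro ⟨rfl, hpos⟩
    rw [zero_smul, add_zero]
    exact h.isQBDGenerator_smul_J1' hpos.le
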